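/- Let $b_n=\binom{2n}{n}/2^n$ for $n=0,1,2,\dots$. A sequence $(m_n)_{n\ge 0}$ of real numbers is a Stieltjes moment sequence if there is a nonnegative Borel measure $\mu$ on $[0,\infty)$ with $m_n=\int_{[0,\infty)}x^n\,d\mu(x)$ for all $n\ge 0$ (all these integrals being finite); it is Stieltjes determinate (S-det) if there is exactly one such measure $\mu$. It is infinitely divisible if $(m_n^c)_{n\ge 0}$ is a Stieltjes moment sequence for every real $c>0$. Then: (a) $(b_n)_{n\ge 0}$ is an infinitely divisible Stieltjes moment sequence. (b) If $Y$ is a real random variable with $E[Y^n]=b_n$ for all $n\ge 0$, then the law of $Y$ has the density $$g(y)=\frac{1}{\pi}\frac{1}{\sqrt{y(2-y)}},\qquad y\in(0,2)$$ (and $g(y)=0$ for $y\notin(0,2)$), and $Y$ has the moment generating function $E[e^{tY}]=e^{t}I_0(t)$ (finite) for all $t\in\mathbb R$, where $I_0(t)=\sum_{k=0}^{\infty}\frac{(t/2)^{2k}}{(k!)^2}$ is the modified Bessel function of the first kind of order $0$. (c) For every real $c>0$ the sequence $(b_n^c)_{n\ge 0}$ is S-det. (d) For every real $c>0$ the measure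 $\mu_c$ on $[0,\infty)$ with moment sequence $(b_n^c)_{n\ge 0}$ has the Mellin transform $$\int_{[0,\infty)}t^s\,d\mu_c(t)=\left(\frac{2^{s}}{\sqrt{\pi}}\cdot\frac{\Gamma(s+1/2)}{\Gamma(s+1)}\right)^c=\left(\frac{1}{2^s}\cdot\frac{\Gamma(2s+1)}{\Gamma(s+1)^2}\right)^c,\qquad s\ge 0.$$ -/

import Mathlib

open MeasureTheory ProbabilityTheory

/-- The normalized central binomial sequence `C(2n, n) / 2^n`. -/
noncomputable def centralBinomSeq (n : ℕ) : ℝ := ((2 * n).choose n : ℝ) / 2 ^ n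

/-- All moments of the measure `μ` on the real line exist, and the `n`-th one is `m n`. -/
def HasMoments (μ : Measure ℝ) (m : ℕ → ℝ) : Prop :=
  ∀ n : ℕ, Integrable (fun x : ℝ => x ^ n) μ ∧ ∫ x, x ^ n ∂μ = m n

/-- `μ` is a measure on `[0, ∞)` with moment sequence `m`. Measures on `[0, ∞)` are encoded as
Borel measures on the real line that give no mass to the negative half-line. -/
def IsStieltjesRepresenting (μ : Measure ℝ) (m : ℕ → ℝ) : Prop :=
  μ (Set.Iio 0) = 0 ∧ HasMoments μ m

/-- `m` is a Stieltjes moment sequence. -/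
def IsStieltjesMomentSeq (m : ℕ → ℝ) : Prop :=
  ∃ μ : Measure ℝ, IsStieltjesRepresenting μ m

/-- `m` is a Stieltjes determinate sequence: it has exactly one representing measure. -/
def IsStieltjesDet (m : ℕ → ℝ) : Prop :=
  ∃! μ : Measure ℝ, IsStieltjesRepresenting μ m

/-- `m` is an infinitely divisible Stieltjes moment sequence: all its positive real powers
(the case `c = 1` being `m` itself) are Stieltjes moment sequences. -/
def IsInfDivStieltjes (m : ℕ → ℝ) : Prop :=
  ∀ c : ℝ, 0 < c → IsStieltjesMomentSeq (fun n => m n ^ c)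

/-- The modified Bessel function of the first kind `I_ν`, of order `ν = 0, 1, 2, …`. -/
noncomputable def besselI (ν : ℕ) (t : ℝ) : ℝ :=
  ∑' k : ℕ, (t / 2) ^ (2 * k + ν) / (k.factorial * Real.Gamma (k + ν + 1))

/-- The series defining `I_ν` converges for every real argument. -/
theorem summable_besselI (ν : ℕ) (t : ℝ) :
    Summable (fun k : ℕ => (t / 2) ^ (2 * k + ν) / (k.factorial * Real.Gamma (k + ν + 1))) := by
  have h : Summable (fun k : ℕ => |t / 2| ^ ν * (((t / 2) ^ 2) ^ k / k.factorial)) :=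
    (Real.summable_pow_div_factorial _).mul_left _
  refine Summable.of_norm_bounded h fun k => ?_
  have hG : Real.Gamma ((k : ℝ) + ν + 1) = ((k + ν).factorial : ℝ) := by
    rw [← Real.Gamma_nat_eq_factorial]
    push_cast
    rfl
  have h1 : (1 : ℝ) ≤ ((k + ν).factorial : ℝ) := by
    exact_mod_cast Nat.succ_le_of_lt (Nat.factorial_pos _)
  have h2 : (0 : ℝ) < (k.factorial : ℝ) := by exact_mod_cast Nat.factorial_pos _
  rw [hG, norm_div, norm_pow, Real.norm_eq_abs, Real.norm_of_nonneg (by positivity), pow_add,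
    pow_mul, sq_abs, mul_comm, mul_div_assoc]
  gcongr
  exact le_mul_of_one_le_right h2.le h1

/-- The function `1 / (π √(y (2 - y)))` on `(0, 2)`, extended by `0`. -/
noncomputable def arcsineDensity : ℝ → ℝ :=
  (Set.Ioo (0 : ℝ) 2).indicator fun y => 1 / (Real.pi * √(y * (2 - y)))

open Filter Topology Set

/-! The sequence is `M n` with `M s = 2 ^ s Γ(s + 1/2) / (√π Γ(s + 1))`. By Euler's limit the Gamma
quotient is a limit of products of factors `p/q * (q + s)/(p + s)` with `p = k + 1/2`, `q = k + 1`.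
The `c`-th power of a factor expands by the negative binomial series, with nonnegative coefficients,
as a mixture of powers of `q / (q + s)`, the Mellin transform of `U ^ (1/q)` with `U` uniform on
`[0, 1]`. Mellin transforms of laws on `[0, 1]` are stable under products, mixtures and pointwise
limits, so `M ^ c` is the Mellin transform of a law on `[0, 2 ^ c]` (`exists_measure_mellin`).

Geometric growth of the moments forces bounded support, and then the characteristic function is a
power series in the moments. Hence the representing measure is unique, even on the whole line
(`HasMoments.measure_eq`). For `c = 1` it is the law of `1 + cos θ` with `θ` uniform on `(0, π)`,
whose generating function is Bessel's integral. -/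

/-! ### Mellin transforms of probability measures on `[0, 1]` -/

/-- `F` is, on `[0, ∞)`, the Mellin transform of a probability measure on the unit interval. -/
def IsUnitMellinTransform (F : ℝ → ℝ) : Prop :=
  ∃ μ : ProbabilityMeasure unitInterval, ∀ s : ℝ, 0 ≤ s →
    ∫ x, (x : ℝ) ^ s ∂(μ : Measure unitInterval) = F s

theorem continuous_unitInterval_rpow {s : ℝ} (hs : 0 ≤ s) :
    Continuous fun x : unitInterval => (x : ℝ) ^ s :=
  continuous_subtype_val.rpow_const fun _ => Or.inr hs

theorem integrable_unitInterval_rpow (μ : Measure unitInterval) [IsFiniteMeasure μ] {s : ℝ}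
    (hs : 0 ≤ s) : Integrable (fun x : unitInterval => (x : ℝ) ^ s) μ :=
  (continuous_unitInterval_rpow hs).integrable_of_hasCompactSupport
    (HasCompactSupport.of_compactSpace _)

namespace IsUnitMellinTransform

theorem one : IsUnitMellinTransform fun _ => 1 := by
  refine ⟨⟨Measure.dirac 1, inferInstance⟩, fun s _ => ?_⟩
  simp

/-- Multiplicative convolution: the law of a product of independent variables. -/
theorem mul {F G : ℝ → ℝ} (hF : IsUnitMellinTransform F) (hG : IsUnitMellinTransform G) :
    IsUnitMellinTransform fun s => F s * G s := by
  obtain ⟨μ, hμ⟩ := hF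
  obtain ⟨ν, hν⟩ := hG
  have hm : Measurable fun z : unitInterval × unitInterval => z.1 * z.2 :=
    (continuous_fst.mul continuous_snd).measurable
  refine ⟨⟨((μ : Measure unitInterval).prod (ν : Measure unitInterval)).map
    (fun z => z.1 * z.2), Measure.isProbabilityMeasure_map hm.aemeasurable⟩, fun s hs => ?_⟩
  rw [ProbabilityMeasure.coe_mk, integral_map hm.aemeasurable
    (continuous_unitInterval_rpow hs).aestronglyMeasurable]
  simp only [← hμ s hs, ← hν s hs]
  rw [← integral_prod_mul]
  refine integral_congr_ae (Eventually.of_forall fun z => ?_)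
  exact Real.mul_rpow z.1.2.1 z.2.2.1

theorem pow {F : ℝ → ℝ} (hF : IsUnitMellinTransform F) (n : ℕ) :
    IsUnitMellinTransform fun s => F s ^ n := by
  induction n with
  | zero => simpa using one
  | succ n ih => simpa [pow_succ] using ih.mul hF

theorem prod {F : ℕ → ℝ → ℝ} (hF : ∀ k, IsUnitMellinTransform (F k)) (n : ℕ) :
    IsUnitMellinTransform fun s => ∏ k ∈ Finset.range n, F k s := by
  induction n with
  | zero => simpa using one
  | succ n ih => simpa [Finset.prod_range_succ] using ih.mul (hF n)

/-- Probability measures on a compact space form a compact space, and `x ^ s` is a bounded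
continuous test function on `[0, 1]` for `s ≥ 0`. An ultrafilter finer than `atTop` replaces the
extraction of a subsequence. -/
theorem tendsto {F : ℕ → ℝ → ℝ} {G : ℝ → ℝ} (hF : ∀ k, IsUnitMellinTransform (F k))
    (h : ∀ s, 0 ≤ s → Tendsto (fun k => F k s) atTop (𝓝 (G s))) : IsUnitMellinTransform G := by
  choose μ hμ using hF
  let U : Ultrafilter ℕ := Ultrafilter.of atTop
  obtain ⟨ν, -, hν⟩ := isCompact_univ.ultrafilter_le_nhds (U.map μ) (by simp)
  have hlim : Tendsto μ U (𝓝 ν) := hν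
  refine ⟨ν, fun s hs => ?_⟩
  have h1 := (ProbabilityMeasure.tendsto_iff_forall_integral_tendsto.1 hlim)
    (BoundedContinuousFunction.mkOfCompact ⟨_, continuous_unitInterval_rpow hs⟩)
  refine tendsto_nhds_unique h1 ?_
  simpa [hμ _ s hs] using (h s hs).mono_left (Ultrafilter.of_le atTop)

theorem mixture {F : ℕ → ℝ → ℝ} {G : ℝ → ℝ} {w : ℕ → ℝ} (hF : ∀ k, IsUnitMellinTransform (F k))
    (hw : ∀ k, 0 ≤ w k) (hw1 : HasSum w 1)
    (h : ∀ s, 0 ≤ s → HasSum (fun k => w k * F k s) (G s)) : IsUnitMellinTransform G := by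
  choose μ hμ using hF
  let ν : Measure unitInterval :=
    Measure.sum fun k => ENNReal.ofReal (w k) • (μ k : Measure unitInterval)
  have hν : IsProbabilityMeasure ν := by
    refine ⟨?_⟩
    simp only [ν, Measure.sum_apply _ MeasurableSet.univ, Measure.smul_apply, measure_univ,
      smul_eq_mul, mul_one]
    rw [← ENNReal.ofReal_tsum_of_nonneg hw hw1.summable, hw1.tsum_eq, ENNReal.ofReal_one]
  refine ⟨⟨ν, hν⟩, fun s hs => ?_⟩
  have h1 := hasSum_integral_measure (μ := fun k => ENNReal.ofReal (w k) •
    (μ k : Measure unitInterval)) (integrable_unitInterval_rpow ν hs)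
  simp only [integral_smul_measure, hμ _ s hs, ENNReal.toReal_ofReal (hw _), smul_eq_mul] at h1
  exact h1.unique (h s hs)

/-- The measure is the law of `U ^ (1/q)` with `U` uniform. -/
theorem div_add {q : ℝ} (hq : 0 < q) : IsUnitMellinTransform fun s => q / (q + s) := by
  have hc : Continuous fun x : unitInterval =>
      (⟨(x : ℝ) ^ q⁻¹, Real.rpow_nonneg x.2.1 _,
        Real.rpow_le_one x.2.1 x.2.2 (inv_nonneg.2 hq.le)⟩ : unitInterval) :=
    (continuous_unitInterval_rpow (inv_nonneg.2 hq.le)).subtype_mk _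
  refine ⟨⟨(volume : Measure unitInterval).map _,
    Measure.isProbabilityMeasure_map hc.measurable.aemeasurable⟩, fun s hs => ?_⟩
  rw [ProbabilityMeasure.coe_mk, integral_map hc.measurable.aemeasurable
    (continuous_unitInterval_rpow hs).aestronglyMeasurable]
  have h1 : ∀ x : unitInterval, ((x : ℝ) ^ q⁻¹) ^ s = (x : ℝ) ^ (q⁻¹ * s) := fun x =>
    (Real.rpow_mul x.2.1 _ _).symm
  have h0 : 0 ≤ q⁻¹ * s := by positivity
  simp only [h1]
  have h2 : ∫ x : unitInterval, (x : ℝ) ^ (q⁻¹ * s) = ∫ x in unitInterval, x ^ (q⁻¹ * s) :=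
    integral_subtype measurableSet_Icc fun x : ℝ => x ^ (q⁻¹ * s)
  rw [h2, unitInterval, integral_Icc_eq_integral_Ioc, ← intervalIntegral.integral_of_le zero_le_one,
    integral_rpow (Or.inl (by linarith)), Real.one_rpow, Real.zero_rpow (by linarith)]
  field_simp
  ring

end IsUnitMellinTransform

/-! ### Positive powers of Gamma quotients -/

theorem ringChoose_nonneg {c : ℝ} (hc : 0 < c) (n : ℕ) : 0 ≤ Ring.choose (c + n - 1) n := by
  have h : (n.factorial : ℝ) * Ring.choose (c + n - 1) n = (ascPochhammer ℝ n).eval c := by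
    rw [Ring.choose, show c + n - 1 - n + 1 = c by ring, ← nsmul_eq_mul,
      Ring.factorial_nsmul_multichoose_eq_ascPochhammer, Polynomial.ascPochhammer_smeval_eq_eval]
  have h2 := (ascPochhammer_pos n c hc).le
  rw [← h] at h2
  exact nonneg_of_mul_nonneg_right h2 (by positivity)

theorem hasSum_ringChoose_mul_pow (c : ℝ) {x : ℝ} (hx : |x| < 1) :
    HasSum (fun n : ℕ => Ring.choose (c + n - 1) n * x ^ n) (1 / (1 - x) ^ c) := by
  have h := (Real.one_div_one_sub_rpow_hasFPowerSeriesOnBall_zero c).hasSum (y := x)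
    (by simpa [enorm_eq_nnnorm] using! hx)
  simpa [FormalMultilinearSeries.ofScalars, mul_comm] using h

/-- With `u = (q - p) / (q + s)` one has `1 - u = (p + s) / (q + s)`, so the function is `(p/q) ^ c
* (1 - u) ^ (-c)`. Writing `u = (q - p)/q * (q / (q + s))` separates the weights from the Mellin
transforms. -/
theorem isUnitMellinTransform_ratio_rpow {p q c : ℝ} (hp : 0 < p) (hpq : p ≤ q) (hc : 0 < c) :
    IsUnitMellinTransform fun s => (p / q * ((q + s) / (p + s))) ^ c := by
  have hq : 0 < q := hp.trans_le hpq
  have key : ∀ s, 0 ≤ s → HasSum (fun n : ℕ => (p / q) ^ c * (Ring.choose (c + n - 1) n *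
      ((q - p) / q) ^ n) * (q / (q + s)) ^ n) ((p / q * ((q + s) / (p + s))) ^ c) := by
    intro s hs
    have hqs : 0 < q + s := by linarith
    have hps : 0 < p + s := by linarith
    have hu : |(q - p) / (q + s)| < 1 := by
      rw [abs_of_nonneg (div_nonneg (by linarith) hqs.le), div_lt_one hqs]
      linarith
    have h := (hasSum_ringChoose_mul_pow c hu).mul_left ((p / q) ^ c)
    have e1 : 1 - (q - p) / (q + s) = ((q + s) / (p + s))⁻¹ := by
      field_simp
      ring
    rw [e1, Real.inv_rpow (by positivity), one_div, inv_inv,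
      ← Real.mul_rpow (by positivity) (by positivity)] at h
    refine h.congr_fun fun n => ?_
    rw [mul_assoc, mul_assoc, ← mul_pow]
    congr 3
    field_simp
  refine IsUnitMellinTransform.mixture
    (fun n => (IsUnitMellinTransform.div_add hq).pow n) (fun n => ?_) ?_ key
  · have := ringChoose_nonneg hc n
    have : 0 ≤ (q - p) / q := div_nonneg (by linarith) hq.le
    positivity
  -- At `s = 0` each component transform is 1, so the expansion there says that the weights sum to
  -- 1.
  · have h := key 0 le_rfl
    simpa [hq.ne', hp.ne'] using h

/-- In the quotient of four Euler sequences the factorials and the powers of `n` cancel, since `b +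
(a + s) = a + (b + s)`. -/
theorem tendsto_prod_gamma_ratio {a b s : ℝ} (ha : 0 < a) (hb : 0 < b) (hs : 0 ≤ s) :
    Tendsto (fun n : ℕ => ∏ k ∈ Finset.range n, (a + k) / (b + k) * ((b + k + s) / (a + k + s)))
      atTop (𝓝 (Real.Gamma b / Real.Gamma a * (Real.Gamma (a + s) / Real.Gamma (b + s)))) := by
  have hG : ∀ x : ℝ, 0 < x → Real.Gamma x ≠ 0 := fun x hx => (Real.Gamma_pos_of_pos hx).ne'
  have h := ((Real.GammaSeq_tendsto_Gamma b).div (Real.GammaSeq_tendsto_Gamma a) (hG a ha)).mul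
    ((Real.GammaSeq_tendsto_Gamma (a + s)).div (Real.GammaSeq_tendsto_Gamma (b + s))
      (hG _ (by linarith)))
  -- `Real.GammaSeq x n` has `n + 1` factors in its denominator.
  rw [← tendsto_add_atTop_iff_nat 1]
  refine h.congr' ?_
  filter_upwards [eventually_gt_atTop 0] with n hn
  have hn' : (0 : ℝ) < n := by exact_mod_cast hn
  have hf : (n.factorial : ℝ) ≠ 0 := by exact_mod_cast n.factorial_ne_zero
  have hP : ∀ x : ℝ, 0 < x → ∏ j ∈ Finset.range (n + 1), (x + j) ≠ 0 := fun x hx =>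
    Finset.prod_ne_zero_iff.2 fun j _ => by positivity
  have e : ∀ x : ℝ, ∏ k ∈ Finset.range (n + 1), (x + k + s) =
      ∏ k ∈ Finset.range (n + 1), (x + s + k) := fun x =>
    Finset.prod_congr rfl fun _ _ => by ring
  simp only [Pi.div_apply, Real.GammaSeq, Finset.prod_mul_distrib, Finset.prod_div_distrib, e,
    Real.rpow_add hn']
  have := hP a ha
  have := hP b hb
  have := hP (a + s) (by linarith)
  have := hP (b + s) (by linarith)
  have := (Real.rpow_pos_of_pos hn' a).ne'
  have := (Real.rpow_pos_of_pos hn' b).ne'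
  have := (Real.rpow_pos_of_pos hn' s).ne'
  field_simp

theorem isUnitMellinTransform_gamma_ratio_rpow {a b c : ℝ} (ha : 0 < a) (hab : a ≤ b)
    (hc : 0 < c) : IsUnitMellinTransform fun s =>
      (Real.Gamma b / Real.Gamma a * (Real.Gamma (a + s) / Real.Gamma (b + s))) ^ c := by
  have hb : 0 < b := ha.trans_le hab
  refine IsUnitMellinTransform.tendsto (F := fun n s => ∏ k ∈ Finset.range n,
    ((a + k) / (b + k) * ((b + k + s) / (a + k + s))) ^ c)
    (IsUnitMellinTransform.prod fun k => isUnitMellinTransform_ratio_rpow (by positivity)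
      (by linarith) hc) fun s hs => ?_
  refine ((tendsto_prod_gamma_ratio ha hb hs).rpow_const (Or.inr hc.le)).congr fun n => ?_
  exact (Real.finsetProd_rpow _ _ (fun k _ => by positivity) _).symm

/-! ### Determinacy from the growth of the moments -/

theorem HasMoments.isFiniteMeasure {μ : Measure ℝ} {m : ℕ → ℝ} (h : HasMoments μ m) :
    IsFiniteMeasure μ := by
  have h0 := (h 0).1
  simp only [pow_zero] at h0
  simpa using integrable_const_iff.1 h0

/-- Markov's inequality for `x ^ (2 * n)` bounds the mass of `{r ≤ |x|}` by `(R / r) ^ (2 * n)`,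
which tends to 0 when `r > R`. -/
theorem HasMoments.ae_abs_le {μ : Measure ℝ} {m : ℕ → ℝ} (h : HasMoments μ m) {R : ℝ}
    (hR : 0 ≤ R) (hm : ∀ n, m (2 * n) ≤ R ^ (2 * n)) : ∀ᵐ x ∂μ, |x| ≤ R := by
  have := h.isFiniteMeasure
  have key : ∀ r, R < r → μ.real {x | r ≤ |x|} = 0 := by
    intro r hr
    have hr0 : 0 < r := hR.trans_lt hr
    have hle : ∀ n : ℕ, μ.real {x | r ≤ |x|} ≤ ((R / r) ^ 2) ^ n := by
      intro n
      have h1 := mul_meas_ge_le_integral_of_nonneg (μ := μ) (f := fun x : ℝ => x ^ (2 * n))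
        (Eventually.of_forall fun x => (even_two_mul n).pow_nonneg x) (h _).1 (r ^ (2 * n))
      rw [(h _).2] at h1
      have h2 : μ.real {x | r ≤ |x|} ≤ μ.real {x | r ^ (2 * n) ≤ x ^ (2 * n)} := by
        refine measureReal_mono fun x hx => ?_
        have hx' : r ≤ |x| := hx
        show r ^ (2 * n) ≤ x ^ (2 * n)
        rw [← (even_two_mul n).pow_abs x]
        gcongr
      rw [← pow_mul, div_pow, le_div_iff₀ (by positivity), mul_comm]
      exact (mul_le_mul_of_nonneg_left h2 (by positivity)).trans (h1.trans (hm n))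
    refine le_antisymm (ge_of_tendsto' (tendsto_pow_atTop_nhds_zero_of_lt_one (by positivity) ?_)
      hle) measureReal_nonneg
    rw [sq_lt_one_iff₀ (by positivity), div_lt_one hr0]
    exact hr
  have h3 : ∀ k : ℕ, ∀ᵐ x ∂μ, |x| < R + 1 / ((k : ℝ) + 1) := by
    intro k
    have h4 := key (R + 1 / ((k : ℝ) + 1)) (by linarith [Nat.one_div_pos_of_nat (α := ℝ) (n := k)])
    rw [measureReal_eq_zero_iff] at h4
    rw [ae_iff]
    simpa using h4
  filter_upwards [ae_all_iff.2 h3] with x hx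
  have hl : Tendsto (fun k : ℕ => R + 1 / ((k : ℝ) + 1)) atTop (𝓝 (R + 0)) :=
    tendsto_const_nhds.add tendsto_one_div_add_atTop_nhds_zero_nat
  rw [add_zero] at hl
  exact ge_of_tendsto' hl fun k => (hx k).le

/-- Serves twice: imaginary `z` gives characteristic functions, real `z` gives Bessel's integral. -/
theorem hasSum_integral_cexp {Ω : Type*} [MeasurableSpace Ω] {μ : Measure Ω} [IsFiniteMeasure μ]
    {X : Ω → ℝ} (hX : AEStronglyMeasurable X μ) {R : ℝ} (hR : ∀ᵐ ω ∂μ, |X ω| ≤ R) (z : ℂ) :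
    HasSum (fun n : ℕ => z ^ n / n.factorial * ((∫ ω, X ω ^ n ∂μ : ℝ) : ℂ))
      (∫ ω, Complex.exp (z * X ω) ∂μ) := by
  have h := hasSum_integral_of_dominated_convergence (μ := μ)
    (F := fun (n : ℕ) ω => (z * X ω) ^ n / n.factorial) (f := fun ω => Complex.exp (z * X ω))
    (fun (n : ℕ) _ => (‖z‖ * R) ^ n / n.factorial) ?_ ?_ ?_ ?_ ?_
  · refine h.congr_fun fun n => ?_
    rw [← integral_complex_ofReal, ← integral_const_mul]
    refine integral_congr_ae (Eventually.of_forall fun ω => ?_)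
    push_cast
    ring
  · intro n
    have h1 : AEStronglyMeasurable (fun ω => (X ω : ℂ)) μ :=
      Complex.continuous_ofReal.comp_aestronglyMeasurable hX
    simp_rw [div_eq_mul_inv]
    exact ((h1.const_mul z).pow n).mul_const _
  · intro n
    filter_upwards [hR] with ω hω
    rw [norm_div, norm_pow, norm_mul, Complex.norm_real, Complex.norm_natCast, Real.norm_eq_abs]
    gcongr
  · exact Eventually.of_forall fun _ => Real.summable_pow_div_factorial _
  · exact integrable_const _
  · refine Eventually.of_forall fun ω => ?_
    rw [Complex.exp_eq_exp_ℂ]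
    exact NormedSpace.expSeries_div_hasSum_exp (z * X ω : ℂ)

theorem HasMoments.measure_eq {μ ν : Measure ℝ} {m : ℕ → ℝ} (hμ : HasMoments μ m)
    (hν : HasMoments ν m) {R : ℝ} (hR : 0 ≤ R) (hm : ∀ n, m (2 * n) ≤ R ^ (2 * n)) : μ = ν := by
  have := hμ.isFiniteMeasure
  have := hν.isFiniteMeasure
  refine Measure.ext_of_charFun (funext fun t => ?_)
  have h1 := hasSum_integral_cexp (X := fun x : ℝ => x) measurable_id.aestronglyMeasurable
    (hμ.ae_abs_le hR hm) (t * Complex.I)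
  have h2 := hasSum_integral_cexp (X := fun x : ℝ => x) measurable_id.aestronglyMeasurable
    (hν.ae_abs_le hR hm) (t * Complex.I)
  simp only [(hμ _).2] at h1
  simp only [(hν _).2] at h2
  have h3 := h1.unique h2
  simp only [charFun_apply_real]
  simpa only [mul_right_comm] using h3

/-! ### The arcsine law -/

/-- Under `y = 1 + cos θ` one has `y * (2 - y) = sin² θ`, so the density cancels the Jacobian up to
`1 / π`. -/
theorem arcsine_eq_map :
    volume.withDensity (fun y => ENNReal.ofReal (arcsineDensity y)) =
      (ENNReal.ofReal (1 / Real.pi) • volume.restrict (Ioo 0 Real.pi)).map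
        (fun θ => 1 + Real.cos θ) := by
  have hm : Measurable fun θ : ℝ => 1 + Real.cos θ := by fun_prop
  have himg : (fun θ => 1 + Real.cos θ) '' Ioo 0 Real.pi = Ioo 0 2 := by
    ext y
    constructor
    · rintro ⟨θ, hθ, rfl⟩
      have h1 := Real.cos_lt_cos_of_nonneg_of_le_pi le_rfl hθ.2.le hθ.1
      have h2 := Real.cos_lt_cos_of_nonneg_of_le_pi hθ.1.le le_rfl hθ.2
      rw [Real.cos_zero] at h1
      rw [Real.cos_pi] at h2
      constructor <;> simp only <;> linarith
    · intro hy
      refine ⟨Real.arccos (y - 1), ⟨Real.arccos_pos.2 (by linarith [hy.2]), ?_⟩, ?_⟩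
      · refine lt_of_le_of_ne (Real.arccos_le_pi _) fun h => ?_
        have := Real.arccos_eq_pi.1 h
        linarith [hy.1]
      · simp only
        rw [Real.cos_arccos (by linarith [hy.1]) (by linarith [hy.2])]
        ring
  have hinj : InjOn (fun θ => 1 + Real.cos θ) (Ioo 0 Real.pi) := fun x hx y hy h =>
    Real.injOn_cos (Ioo_subset_Icc_self hx) (Ioo_subset_Icc_self hy) (add_left_cancel h)
  ext s hs
  rw [withDensity_apply _ hs, Measure.map_apply hm hs, Measure.smul_apply,
    Measure.restrict_apply (hm hs), smul_eq_mul, ← lintegral_indicator hs]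
  have h1 : ∫⁻ y, s.indicator (fun y => ENNReal.ofReal (arcsineDensity y)) y =
      ∫⁻ y in Ioo 0 2, s.indicator (fun y => ENNReal.ofReal (arcsineDensity y)) y := by
    rw [← lintegral_indicator measurableSet_Ioo]
    refine lintegral_congr fun y => ?_
    by_cases hy : y ∈ Ioo (0 : ℝ) 2
    · rw [indicator_of_mem hy]
    · rw [indicator_of_notMem hy]
      simp [indicator, arcsineDensity, hy]
  rw [h1, ← himg, lintegral_image_eq_lintegral_abs_deriv_mul measurableSet_Ioo
    (f' := fun θ => -Real.sin θ)
    (fun θ _ => ((Real.hasDerivAt_cos θ).const_add 1).hasDerivWithinAt) hinj]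
  have h2 : ∀ θ ∈ Ioo 0 Real.pi, ENNReal.ofReal |-Real.sin θ| *
      s.indicator (fun y => ENNReal.ofReal (arcsineDensity y)) (1 + Real.cos θ) =
      ((fun θ => 1 + Real.cos θ) ⁻¹' s).indicator (fun _ => ENNReal.ofReal (1 / Real.pi)) θ := by
    intro θ hθ
    have hs0 := Real.sin_pos_of_pos_of_lt_pi hθ.1 hθ.2
    have hmem : 1 + Real.cos θ ∈ Ioo (0 : ℝ) 2 := himg ▸ mem_image_of_mem _ hθ
    by_cases hc : 1 + Real.cos θ ∈ s
    · rw [indicator_of_mem hc, indicator_of_mem (by exact hc), ← ENNReal.ofReal_mul (abs_nonneg _),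
        arcsineDensity, indicator_of_mem hmem, abs_neg, abs_of_pos hs0,
        show (1 + Real.cos θ) * (2 - (1 + Real.cos θ)) = Real.sin θ ^ 2 by
          rw [Real.sin_sq]; ring, Real.sqrt_sq hs0.le]
      congr 1
      field_simp
    · rw [indicator_of_notMem hc, indicator_of_notMem (by exact hc), mul_zero]
  rw [setLIntegral_congr_fun measurableSet_Ioo h2, lintegral_indicator (hm hs),
    setLIntegral_const, Measure.restrict_apply (hm hs)]

theorem integral_arcsine {h : ℝ → ℝ} (hc : Continuous h) :
    ∫ y, h y ∂(volume.withDensity fun y => ENNReal.ofReal (arcsineDensity y)) =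
      1 / Real.pi * ∫ θ in (0)..Real.pi, h (1 + Real.cos θ) := by
  have hm : Measurable fun θ : ℝ => 1 + Real.cos θ := by fun_prop
  rw [arcsine_eq_map, integral_map hm.aemeasurable hc.aestronglyMeasurable, integral_smul_measure,
    ENNReal.toReal_ofReal (by positivity), intervalIntegral.integral_of_le Real.pi_pos.le,
    integral_Ioc_eq_integral_Ioo, smul_eq_mul]

theorem integrable_arcsine {h : ℝ → ℝ} (hc : Continuous h) :
    Integrable h (volume.withDensity fun y => ENNReal.ofReal (arcsineDensity y)) := by
  have hm : Measurable fun θ : ℝ => 1 + Real.cos θ := by fun_prop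
  rw [arcsine_eq_map, integrable_map_measure hc.aestronglyMeasurable hm.aemeasurable]
  refine Integrable.smul_measure ?_ ENNReal.ofReal_ne_top
  have hcc : Continuous (h ∘ fun θ => 1 + Real.cos θ) := by fun_prop
  exact (hcc.integrableOn_Icc (a := 0) (b := Real.pi)).mono_set Ioo_subset_Icc_self

/-! ### Trigonometric integrals and Bessel's integral -/

theorem prod_odd_div_even (n : ℕ) :
    ∏ i ∈ Finset.range n, ((2 * (i : ℝ) + 1) / (2 * i + 2)) = (n.centralBinom : ℝ) / 4 ^ n := by
  induction n with
  | zero => simp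
  | succ n ih =>
    have h : ((n : ℝ) + 1) * (n + 1).centralBinom = 2 * (2 * n + 1) * n.centralBinom := by
      exact_mod_cast n.succ_mul_centralBinom_succ
    rw [Finset.prod_range_succ, ih, pow_succ, div_mul_div_comm, div_eq_div_iff (by positivity)
      (by positivity)]
    linear_combination (-4 ^ n * 2) * h

/-- The half-angle formula `1 + cos θ = 2 cos² (θ/2)` reduces this to a Wallis integral over `[0,
π/2]`. -/
theorem integral_one_add_cos_pow (n : ℕ) :
    ∫ θ in (0)..Real.pi, (1 + Real.cos θ) ^ n = Real.pi * ((n.centralBinom : ℝ) / 2 ^ n) := by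
  have h1 : ∀ θ : ℝ, (1 + Real.cos θ) ^ n = 2 ^ n * Real.cos (θ / 2) ^ (2 * n) := by
    intro θ
    rw [pow_mul, Real.cos_sq, ← mul_pow]
    congr 1
    ring_nf
  simp_rw [h1]
  rw [intervalIntegral.integral_const_mul,
    intervalIntegral.integral_comp_div (fun x => Real.cos x ^ (2 * n)) two_ne_zero, zero_div,
    EulerSine.integral_cos_pow_eq, integral_sin_pow_even, prod_odd_div_even,
    show (4 : ℝ) ^ n = 2 ^ n * 2 ^ n by rw [← mul_pow]; norm_num]
  simp only [smul_eq_mul]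
  field_simp

theorem integral_cos_pow_even (n : ℕ) :
    ∫ θ in (0)..Real.pi, Real.cos θ ^ (2 * n) = Real.pi * ((n.centralBinom : ℝ) / 4 ^ n) := by
  rw [← prod_odd_div_even]
  induction n with
  | zero => simp
  | succ n ih =>
    rw [Finset.prod_range_succ, mul_add, mul_one, integral_cos_pow, ih]
    simp
    ring

theorem integral_cos_pow_odd (n : ℕ) : ∫ θ in (0)..Real.pi, Real.cos θ ^ (2 * n + 1) = 0 := by
  induction n with
  | zero => simp
  | succ n ih =>
    rw [show 2 * (n + 1) + 1 = 2 * n + 1 + 2 by ring, integral_cos_pow, ih]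
    simp

theorem hasMoments_arcsine :
    HasMoments (volume.withDensity fun y => ENNReal.ofReal (arcsineDensity y))
      centralBinomSeq := by
  refine fun n => ⟨integrable_arcsine (by fun_prop), ?_⟩
  rw [integral_arcsine (by fun_prop), integral_one_add_cos_pow, centralBinomSeq,
    Nat.centralBinom_eq_two_mul_choose]
  field_simp

/-- Expand the exponential and integrate termwise; the even terms match the Bessel series because
`(2k)! = (k!)² * k.centralBinom`. -/
theorem integral_exp_mul_cos (t : ℝ) :
    ∫ θ in (0)..Real.pi, Real.exp (t * Real.cos θ) = Real.pi * besselI 0 t := by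
  have h := hasSum_integral_cexp (μ := volume.restrict (Ioc 0 Real.pi)) (X := Real.cos)
    Real.continuous_cos.aestronglyMeasurable
    (Eventually.of_forall fun θ => Real.abs_cos_le_one θ) t
  have h' : HasSum (fun n : ℕ => t ^ n / n.factorial * ∫ θ in (0)..Real.pi, Real.cos θ ^ n)
      (∫ θ in (0)..Real.pi, Real.exp (t * Real.cos θ)) := by
    simp_rw [intervalIntegral.integral_of_le Real.pi_pos.le]
    rw [← Complex.hasSum_ofReal]
    convert h using 1
    · ext n
      push_cast
      rfl
    · rw [← integral_complex_ofReal]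
      push_cast
      rfl
  have hinj : Function.Injective fun k : ℕ => 2 * k := fun a b hab => by
    simpa using hab
  -- Only even exponents survive, so the sum is reindexed along `n = 2 * k`.
  rw [← hinj.hasSum_iff] at h'
  · refine h'.unique ?_
    have hb := ((summable_besselI 0 t).hasSum).mul_left Real.pi
    refine hb.congr_fun fun k => ?_
    have h1 : ((2 * k).factorial : ℝ) = k.factorial * k.factorial * k.centralBinom := by
      rw [Nat.centralBinom_eq_two_mul_choose]
      have h2 := Nat.choose_mul_factorial_mul_factorial (by omega : k ≤ 2 * k)
      rw [show 2 * k - k = k by omega, mul_assoc, mul_comm] at h2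
      exact_mod_cast h2.symm
    have h3 : (k.centralBinom : ℝ) ≠ 0 := by exact_mod_cast k.centralBinom_ne_zero
    have h4 : (4 : ℝ) ^ k = 2 ^ (2 * k) := by rw [pow_mul]; norm_num
    rw [Function.comp_apply, integral_cos_pow_even, h1, h4, Nat.cast_zero, add_zero, add_zero,
      Real.Gamma_nat_eq_factorial, div_pow]
    field_simp
  · intro n hn
    obtain ⟨k, rfl | rfl⟩ := n.even_or_odd'
    · exact absurd ⟨k, rfl⟩ hn
    · rw [integral_cos_pow_odd, mul_zero]

/-! ### Powers of the central binomial sequence -/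

/-- Legendre's duplication formula at `s + 1/2`. -/
theorem centralBinom_mellin_eq {s : ℝ} (hs : 0 ≤ s) :
    2 ^ s / √Real.pi * (Real.Gamma (s + 1 / 2) / Real.Gamma (s + 1)) =
      1 / 2 ^ s * (Real.Gamma (2 * s + 1) / Real.Gamma (s + 1) ^ 2) := by
  have h := Real.Gamma_mul_Gamma_add_half (s + 1 / 2)
  rw [show s + 1 / 2 + 1 / 2 = s + 1 by ring, show 2 * (s + 1 / 2) = 2 * s + 1 by ring,
    show 1 - (2 * s + 1) = -(s + s) by ring, Real.rpow_neg zero_le_two,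
    Real.rpow_add zero_lt_two] at h
  have hG : Real.Gamma (s + 1) ≠ 0 := (Real.Gamma_pos_of_pos (by linarith)).ne'
  have h2 : (2 : ℝ) ^ s ≠ 0 := (Real.rpow_pos_of_pos zero_lt_two s).ne'
  have hpi : √Real.pi ≠ 0 := (Real.sqrt_pos.2 Real.pi_pos).ne'
  field_simp at h ⊢
  linear_combination h

theorem centralBinomSeq_eq_mellin (n : ℕ) :
    2 ^ (n : ℝ) / √Real.pi * (Real.Gamma (n + 1 / 2) / Real.Gamma (n + 1)) =
      centralBinomSeq n := by
  have h1 : Real.Gamma (2 * n + 1) = ((2 * n).factorial : ℝ) := by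
    rw [← Real.Gamma_nat_eq_factorial]
    push_cast
    rfl
  rw [centralBinom_mellin_eq n.cast_nonneg, h1, Real.Gamma_nat_eq_factorial, Real.rpow_natCast,
    centralBinomSeq, Nat.cast_choose ℝ (by omega : n ≤ 2 * n), show 2 * n - n = n by omega]
  ring

theorem exists_measure_mellin {c : ℝ} (hc : 0 < c) : ∃ ν : Measure ℝ, ν (Iio 0) = 0 ∧
    ∀ s : ℝ, 0 ≤ s → Integrable (fun x : ℝ => x ^ s) ν ∧ ∫ x, x ^ s ∂ν =
      (2 ^ s / √Real.pi * (Real.Gamma (s + 1 / 2) / Real.Gamma (s + 1))) ^ c := by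
  -- Since `Γ(1/2) = √π` and `Γ(1) = 1`, this choice yields the target without `(2 ^ s) ^ c`;
  -- dilating the measure by `2 ^ c` supplies that factor.
  obtain ⟨μ, hμ⟩ := isUnitMellinTransform_gamma_ratio_rpow (a := 1 / 2) (b := 1) (by norm_num)
    (by norm_num) hc
  have hm : Measurable fun x : unitInterval => (2 : ℝ) ^ c * (x : ℝ) := by fun_prop
  have h2c : (0 : ℝ) < 2 ^ c := by positivity
  have hcont : ∀ s : ℝ, 0 ≤ s → Continuous fun x : ℝ => x ^ s := fun s hs =>
    continuous_id.rpow_const fun _ => Or.inr hs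
  have hmul : ∀ (s : ℝ) (x : unitInterval), ((2 : ℝ) ^ c * (x : ℝ)) ^ s =
      ((2 : ℝ) ^ c) ^ s * (x : ℝ) ^ s := fun s x => Real.mul_rpow h2c.le x.2.1
  refine ⟨(μ : Measure unitInterval).map fun x : unitInterval => (2 : ℝ) ^ c * (x : ℝ), ?_, fun s hs =>
    ⟨?_, ?_⟩⟩
  · rw [Measure.map_apply hm measurableSet_Iio]
    convert measure_empty (μ := (μ : Measure unitInterval))
    ext x
    simpa using mul_nonneg h2c.le x.2.1
  · rw [integrable_map_measure (hcont s hs).aestronglyMeasurable hm.aemeasurable]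
    simp only [Function.comp_def, hmul]
    exact (integrable_unitInterval_rpow _ hs).const_mul _
  · rw [integral_map hm.aemeasurable (hcont s hs).aestronglyMeasurable]
    simp only [hmul]
    have hG1 := Real.Gamma_pos_of_pos (show 0 < 1 / 2 + s by linarith)
    have hG2 := Real.Gamma_pos_of_pos (show 0 < 1 + s by linarith)
    rw [integral_const_mul, hμ s hs, ← Real.rpow_mul zero_le_two, mul_comm c s,
      Real.rpow_mul zero_le_two, Real.Gamma_one, Real.Gamma_one_half_eq,
      ← Real.mul_rpow (by positivity) (by positivity), add_comm s, add_comm s]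
    congr 1
    ring

theorem exists_representing_mellin {c : ℝ} (hc : 0 < c) :
    ∃ ν : Measure ℝ, IsStieltjesRepresenting ν (fun n => centralBinomSeq n ^ c) ∧
      ∀ s : ℝ, 0 ≤ s → Integrable (fun x : ℝ => x ^ s) ν ∧ ∫ x, x ^ s ∂ν =
        (2 ^ s / √Real.pi * (Real.Gamma (s + 1 / 2) / Real.Gamma (s + 1))) ^ c := by
  obtain ⟨ν, h0, hν⟩ := exists_measure_mellin hc
  refine ⟨ν, ⟨h0, fun n => ?_⟩, hν⟩
  have h := hν n n.cast_nonneg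
  simp only [Real.rpow_natCast _ n] at h
  rw [← Real.rpow_natCast 2 n, centralBinomSeq_eq_mellin] at h
  exact h

/-- The crude bound `C(2n, n) ≤ 4 ^ n` gives the support radius `2 ^ c` needed for determinacy. -/
theorem centralBinomSeq_rpow_le {c : ℝ} (hc : 0 < c) (n : ℕ) :
    centralBinomSeq n ^ c ≤ ((2 : ℝ) ^ c) ^ n := by
  have h0 : 0 ≤ centralBinomSeq n := by
    unfold centralBinomSeq
    positivity
  have h1 : centralBinomSeq n ≤ 2 ^ n := by
    rw [centralBinomSeq, div_le_iff₀ (by positivity), ← pow_add, ← two_mul]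
    exact_mod_cast Nat.choose_le_two_pow _ _
  rw [← Real.rpow_natCast, ← Real.rpow_mul zero_le_two, mul_comm c, Real.rpow_mul zero_le_two,
    Real.rpow_natCast]
  exact Real.rpow_le_rpow h0 h1 hc.le

theorem IsStieltjesRepresenting.measure_eq_of_centralBinomSeq {c : ℝ} (hc : 0 < c)
    {μ ν : Measure ℝ} (hμ : IsStieltjesRepresenting μ (fun n => centralBinomSeq n ^ c))
    (hν : IsStieltjesRepresenting ν (fun n => centralBinomSeq n ^ c)) : μ = ν :=
  hμ.2.measure_eq hν.2 (by positivity) fun n => centralBinomSeq_rpow_le hc (2 * n)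

theorem HasMoments.eq_arcsine {μ : Measure ℝ} (hμ : HasMoments μ centralBinomSeq) :
    μ = volume.withDensity fun y => ENNReal.ofReal (arcsineDensity y) :=
  hμ.measure_eq hasMoments_arcsine zero_le_two fun n => by
    simpa using centralBinomSeq_rpow_le one_pos (2 * n)

theorem mainTheorem3 :
    -- (a) infinite divisibility
    IsInfDivStieltjes centralBinomSeq ∧
    -- (b) density and moment generating function
    (∀ (Ω : Type*) [MeasurableSpace Ω] (P : Measure Ω) [IsProbabilityMeasure P] (Y : Ω → ℝ),
      AEMeasurable Y P → HasMoments (P.map Y) centralBinomSeq →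
        P.map Y = volume.withDensity (fun y => ENNReal.ofReal (arcsineDensity y)) ∧
        ∀ t : ℝ, Integrable (fun ω => Real.exp (t * Y ω)) P ∧
          mgf Y P t = Real.exp t * besselI 0 t) ∧
    -- (c) determinacy of all positive powers
    (∀ c : ℝ, 0 < c → IsStieltjesDet (fun n => centralBinomSeq n ^ c)) ∧
    -- (d) the Mellin transform of the representing measure of each positive power
    (∀ c : ℝ, 0 < c → ∀ μ : Measure ℝ,
      IsStieltjesRepresenting μ (fun n => centralBinomSeq n ^ c) →
        ∀ s : ℝ, 0 ≤ s →
          Integrable (fun x : ℝ => x ^ s) μ ∧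
          ∫ x, x ^ s ∂μ =
            (2 ^ s / √Real.pi * (Real.Gamma (s + 1 / 2) / Real.Gamma (s + 1))) ^ c ∧
          ∫ x, x ^ s ∂μ =
            (1 / 2 ^ s * (Real.Gamma (2 * s + 1) / Real.Gamma (s + 1) ^ 2)) ^ c) := by

  refine ⟨fun c hc => ?_, ?_, fun c hc => ?_, ?_⟩
  · obtain ⟨ν, hν, -⟩ := exists_representing_mellin hc
    exact ⟨ν, hν⟩
  · intro Ω _ P _ Y hY hmom
    have hlaw := hmom.eq_arcsine
    refine ⟨hlaw, fun t => ?_⟩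
    have hc : Continuous fun y : ℝ => Real.exp (t * y) := by fun_prop
    constructor
    · have h := integrable_arcsine hc
      rw [← hlaw, integrable_map_measure hc.aestronglyMeasurable hY] at h
      exact h
    · have h := integral_arcsine hc
      rw [← hlaw, integral_map hY hc.aestronglyMeasurable] at h
      rw [mgf, h]
      -- The shift in `1 + cos θ` produces the factor `exp t`.
      simp only [mul_add, mul_one, Real.exp_add]
      rw [intervalIntegral.integral_const_mul, integral_exp_mul_cos]
      field_simp
  · obtain ⟨ν, hν, -⟩ := exists_representing_mellin hc
    exact ⟨ν, hν, fun μ hμ => hμ.measure_eq_of_centralBinomSeq hc hν⟩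
  · intro c hc μ hμ s hs
    obtain ⟨ν, hν, hmel⟩ := exists_representing_mellin hc
    -- Determinacy identifies `μ` with the constructed measure, whose Mellin transform is known at
    -- every real `s ≥ 0`.
    rw [hμ.measure_eq_of_centralBinomSeq hc hν, ← centralBinom_mellin_eq hs]
    exact ⟨(hmel s hs).1, (hmel s hs).2, (hmel s hs).2⟩
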